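/- Let $G$ be a (finite-dimensional) complex Lie group with Lie algebra $\mathcal G$ and identity $e$, and let $\langle\ ,\ \rangle$ be a non-degenerate, symmetric, ad-invariant complex bilinear form on $\mathcal G$. Let $\tau$ be an involutive automorphism of $G$ (as a real Lie group) whose differential at $e$, also denoted $\tau$, is conjugate linear on $\mathcal G$ and satisfies $\langle\tau\xi,\tau\eta\rangle=\overline{\langle\xi,\eta\rangle}$. Let $U\subset G$ be the fixed point set of $\tau$, $\mathcal U=\{\xi\in\mathcal G:\tau\xi=\xi\}$ its Lie algebra, with the pseudo-metric on $U$ obtained by left translating $\langle\ ,\ \rangle|_{\mathcal U}$. Let $a,b\in\mathcal U$ with $[a,b]=0$, let $\mathcal U_a^\perp$ be the orthogonal complement in $\mathcal U$ of $\{\eta\in\mathcal U:[a,\eta]=0\}$, and let $g:\mathbb R^2\to U$ be a smooth solution of the $-1$-flow associated to $U$: $$(g^{-1}g_x)_t=[a,g^{-1}bg],\qquad g^{-1}g_x\in\mathcal U_a^\perp .$$ For $\lambda\in\mathbb C\setminus\{0\}$ let $E_\lambda:\mathbb R^2\to G$ be the frame of its Lax pair, i.e. the smooth map with $$E_\lambda^{-1}dE_\lambda=(a\lambda+g^{-1}g_x)\,dx+\lambda^{-1}g^{-1}bg\,dt,\qquad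 E_\lambda(0,0)=e .$$ Let $\mathbb R^{1,1}$ be the plane with the Lorentz metric $2\,dx\,dt$. For a submanifold $N\subset U$, a smooth map $s:\mathbb R^{1,1}\to N$ is called harmonic if it is a critical point of the energy $\int\langle s^{-1}s_x,s^{-1}s_t\rangle\,dx\,dt$ with respect to all compactly supported smooth variations through maps into $N$. Then: 1. $s=E_{-1}E_1^{-1}$ takes values in $U$ and is a harmonic map from $\mathbb R^{1,1}$ to $U$. 2. Suppose moreover that $\sigma$ is an automorphism of $G$ of order $2m$ ($m\ge1$) whose differential at $e$ is complex linear, that $\tau\sigma=\sigma^{-1}\tau$, that $a\in\mathcal G_1$ and $b\in\mathcal G_{-1}$, where $\mathcal G_j$ is the eigenspace of $\sigma$ on $\mathcal G$ for the eigenvalue $e^{2\pi ij/(2m)}$, and that $g$ solves the $-1$-flow associated to $U/U_0$, i.e. $g$ takes values in $U_0=\{u\in U:\sigma(u)=u\}$. Let $H$ be the fixed point set of $\sigma^m$ in $U$. Then $s=E_{-1}E_1^{-1}$ is a harmonic map from $\mathbb R^{1,1}$ to the symmetric space $U/H$, where $U/H$ is identified with the submanifold $\{u\,\sigma^m(u)^{-1}:u\in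 U\}$ of $U$ by the Cartan embedding $uH\mapsto u\,\sigma^m(u)^{-1}$, with the induced metric. -/

import Mathlib

open scoped Manifold ContDiff

noncomputable section

namespace LaxFlow

/-! Throughout, `G` is a complex Lie group modelled on the finite-dimensional complex vector space
`V`. Its Lie algebra `𝒢`, the tangent space at the identity, is `V` itself (read in the preferred
chart at the identity). Points of the plane are pairs `p = (x, t)`. -/

variable {V : Type*} [NormedAddCommGroup V] [NormedSpace ℂ V]
variable {G : Type*} [TopologicalSpace G] [ChartedSpace V G] [Group G]

variable (V) in
/-- A smooth map from the plane to `G`. -/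
def SmoothPlaneMap (f : ℝ × ℝ → G) : Prop :=
  ContMDiff 𝓘(ℝ, ℝ × ℝ) 𝓘(ℝ, V) ∞ f

variable (G) in
/-- The Lie bracket of `𝒢`: the value at the identity of the bracket of left-invariant vector
fields. -/
def bracket (ξ η : V) : V :=
  let ξ' : GroupLieAlgebra 𝓘(ℝ, V) G := ξ
  let η' : GroupLieAlgebra 𝓘(ℝ, V) G := η
  (⁅ξ', η'⁆ : GroupLieAlgebra 𝓘(ℝ, V) G)

/-- The differential at the identity of a group automorphism of `G`. -/
def differential (φ : G ≃* G) (ξ : V) : V :=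
  mfderiv 𝓘(ℝ, V) 𝓘(ℝ, V) (fun x : G => φ x) 1 ξ

/-- The adjoint action of `G` on `𝒢`, written `h ξ h⁻¹` for matrix groups. -/
def adjoint (h : G) (ξ : V) : V :=
  mfderiv 𝓘(ℝ, V) 𝓘(ℝ, V) (fun x : G => h * x * h⁻¹) 1 ξ

/-- The left logarithmic derivative `f⁻¹ df` of `f` at `p` in the direction `w`: the derivative
at `p` of `q ↦ f(p)⁻¹ f(q)`, which passes through the identity at `q = p`. -/
def leftLogDeriv (f : ℝ × ℝ → G) (p w : ℝ × ℝ) : V :=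
  mfderiv 𝓘(ℝ, ℝ × ℝ) 𝓘(ℝ, V) (fun q => (f p)⁻¹ * f q) p w

variable (V) in
/-- `f⁻¹ f_x`. -/
def logDx (f : ℝ × ℝ → G) (p : ℝ × ℝ) : V := leftLogDeriv f p (1, 0)

variable (V) in
/-- `f⁻¹ f_t`. -/
def logDt (f : ℝ × ℝ → G) (p : ℝ × ℝ) : V := leftLogDeriv f p (0, 1)

variable (V) in
/-- `τ` is an involution of `G` whose differential at the identity is conjugate linear. -/
structure IsConjInvolution (τ : G ≃* G) : Prop where
  smooth : ContMDiff 𝓘(ℝ, V) 𝓘(ℝ, V) ∞ (fun x : G => τ x)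
  involutive : ∀ x, τ (τ x) = x
  conj_linear : ∀ (c : ℂ) (ξ : V),
    differential τ (c • ξ) = (starRingEnd ℂ) c • differential τ ξ

variable (V) in
/-- `σ` is an automorphism of `G` of order exactly `k`, with complex linear differential at the
identity. -/
structure IsComplexAutOfOrder (σ : G ≃* G) (k : ℕ) : Prop where
  smooth : ContMDiff 𝓘(ℝ, V) 𝓘(ℝ, V) ∞ (fun x : G => σ x)
  complex_linear : ∀ (c : ℂ) (ξ : V), differential σ (c • ξ) = c • differential σ ξ
  order_pos : 0 < k
  order_eq : orderOf (σ : MulAut G) = k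

/-- The subgroup of fixed points of an automorphism. For `τ` this is the real form `U`; it is
a closed subgroup, so a smooth map into it is a smooth map into `G` taking values in it. -/
def fixedSubgroup (φ : G ≃* G) : Subgroup G where
  carrier := {x | φ x = x}
  mul_mem' := by
    intro x y hx hy
    simp only [Set.mem_ofPred_eq] at hx hy ⊢
    rw [map_mul, hx, hy]
  one_mem' := map_one φ
  inv_mem' := by
    intro x hx
    simp only [Set.mem_ofPred_eq] at hx ⊢
    rw [map_inv, hx]

/-- The eigenspace `𝒢_j` of `σ` on `𝒢`, for the eigenvalue `exp (2 π i j / k)`. -/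
def eigenspace (σ : G ≃* G) (k : ℕ) (j : ℤ) : Set V :=
  {ξ | differential σ ξ = Complex.exp (2 * Real.pi * Complex.I * j / k) • ξ}

/-- The real form `𝒰` of `𝒢`, the Lie algebra of `U`. -/
def realForm (τ : G ≃* G) : Set V := {ξ | differential τ ξ = ξ}

/-- `𝒰_a^⊥`: the orthogonal complement in `𝒰` of the centralizer of `a` in `𝒰`. -/
def centralizerPerp (τ : G ≃* G) (B : LinearMap.BilinForm ℂ V) (a : V) : Set V :=
  {ξ | ξ ∈ realForm τ ∧ ∀ η ∈ realForm τ, bracket G a η = 0 → B ξ η = 0}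

variable (G) in
/-- A non-degenerate, symmetric, ad-invariant complex bilinear form on `𝒢`. -/
structure IsInvariantForm (B : LinearMap.BilinForm ℂ V) : Prop where
  symm : ∀ ξ η, B ξ η = B η ξ
  nondegenerate : B.Nondegenerate
  ad_invariant : ∀ ξ η ζ, B (bracket G ξ η) ζ = B ξ (bracket G η ζ)

/-- The form is compatible with `τ`; in particular it is real-valued on `𝒰`. -/
def IsRealFor (τ : G ≃* G) (B : LinearMap.BilinForm ℂ V) : Prop :=
  ∀ ξ η, B (differential τ ξ) (differential τ η) = (starRingEnd ℂ) (B ξ η)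

/-- `g : ℝ² → U` is a solution of the `-1`-flow `(g⁻¹ g_x)_t = [a, g⁻¹ b g]`,
`g⁻¹ g_x ∈ 𝒰_a^⊥`, associated to `U` and defined by `a`, `b`. -/
structure IsMinusOneFlow (τ : G ≃* G) (B : LinearMap.BilinForm ℂ V) (a b : V)
    (g : ℝ × ℝ → G) : Prop where
  smooth : SmoothPlaneMap V g
  mem_U : ∀ p, g p ∈ fixedSubgroup τ
  perp : ∀ p, logDx V g p ∈ centralizerPerp τ B a
  flow : ∀ p, fderiv ℝ (fun q => logDx V g q) p (0, 1) = bracket G a (adjoint (g p)⁻¹ b)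

/-- `F` is the frame of the Lax pair
`θ_lam = (a lam + g⁻¹ g_x) dx + lam⁻¹ g⁻¹ b g dt`, that is `F⁻¹ dF = θ_lam` and `F(0,0) = e`. -/
structure IsFrame (a b : V) (g : ℝ × ℝ → G) (lam : ℂ) (F : ℝ × ℝ → G) : Prop where
  smooth : SmoothPlaneMap V F
  initial : F (0, 0) = 1
  eq_x : ∀ p, logDx V F p = lam • a + logDx V g p
  eq_t : ∀ p, logDt V F p = lam⁻¹ • adjoint (g p)⁻¹ b

/-- The energy density of `s : ℝ^{1,1} → G`, the plane carrying the metric `2 dx dt` and `G` the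
left-invariant pseudo-metric that extends `Re B`. The inverse of `2 dx dt` has the entries
`h^{xt} = h^{tx} = 1`, `h^{xx} = h^{tt} = 0`, hence `(1/2) h^{ij} ⟨s_i, s_j⟩ = ⟨s_x, s_t⟩`; the area
element is `dx dt`. If `s` takes values in `U` and `B` is real on `𝒰`, then `Re B` is `B` here. -/
def energyDensity (B : LinearMap.BilinForm ℂ V) (s : ℝ × ℝ → G) (p : ℝ × ℝ) : ℝ :=
  (B (logDx V s p) (logDt V s p)).re

/-- `S` is a smooth variation of `s` through maps into `N`, supported in `K`. -/
structure IsVariation (V : Type*) [NormedAddCommGroup V] [NormedSpace ℂ V]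
    {G : Type*} [TopologicalSpace G] [ChartedSpace V G]
    (N : Set G) (s : ℝ × ℝ → G) (K : Set (ℝ × ℝ)) (S : ℝ → ℝ × ℝ → G) : Prop where
  smooth : ContMDiff 𝓘(ℝ, ℝ × (ℝ × ℝ)) 𝓘(ℝ, V) ∞ (fun z : ℝ × (ℝ × ℝ) => S z.1 z.2)
  mem : ∀ ε p, S ε p ∈ N
  start : ∀ p, S 0 p = s p
  support : ∀ ε, ∀ p ∉ K, S ε p = s p

/-- `s` is a harmonic map from the Lorentz plane `ℝ^{1,1}` to the submanifold `N` of `G`, with the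
induced pseudo-metric: `s` is a smooth map into `N` and a critical point of the energy under all
compactly supported smooth variations through maps into `N`. -/
def IsHarmonicInto (B : LinearMap.BilinForm ℂ V) (N : Set G) (s : ℝ × ℝ → G) : Prop :=
  SmoothPlaneMap V s ∧ (∀ p, s p ∈ N) ∧
    ∀ (K : Set (ℝ × ℝ)) (S : ℝ → ℝ × ℝ → G), IsCompact K → IsVariation V N s K S →
      HasDerivAt (fun ε : ℝ => ∫ p in K, energyDensity B (S ε) p) 0 0

/-- `H`, the fixed point set of `ρ` in `U`, as a subgroup of `U`. -/
def isotropy (τ ρ : G ≃* G) : Subgroup (fixedSubgroup τ) :=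
  (fixedSubgroup ρ).subgroupOf (fixedSubgroup τ)

/-- The Cartan embedding `U/H → U ⊆ G`, `u H ↦ u ρ(u)⁻¹`, of the symmetric space `U/H`, where `H` is
the fixed point set in `U` of the involution `ρ`. -/
def cartanEmbedding (τ ρ : G ≃* G) : (fixedSubgroup τ ⧸ isotropy τ ρ) → G :=
  Quotient.lift (fun u : fixedSubgroup τ => (u : G) * (ρ (u : G))⁻¹) (by
    intro u v huv
    have h : u⁻¹ * v ∈ isotropy τ ρ := QuotientGroup.leftRel_apply.mp huv
    have h' : ρ ((u : G)⁻¹ * v) = (u : G)⁻¹ * v := h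
    rw [map_mul, map_inv] at h'
    have h2 : ρ (v : G) = ρ (u : G) * ((u : G)⁻¹ * v) := by rw [← h']; group
    change (u : G) * (ρ (u : G))⁻¹ = (v : G) * (ρ (v : G))⁻¹
    rw [h2]
    group)

/-- The Cartan embedding is indeed injective. -/
theorem cartanEmbedding_injective {G : Type*} [Group G] (τ ρ : G ≃* G) :
    Function.Injective (cartanEmbedding τ ρ) := by
  intro x y
  refine Quotient.inductionOn₂ x y ?_
  intro u v h
  have h1 : (u : G) * (ρ (u : G))⁻¹ = (v : G) * (ρ (v : G))⁻¹ := h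
  apply Quotient.sound
  apply QuotientGroup.leftRel_apply.mpr
  change ρ ((u : G)⁻¹ * v) = (u : G)⁻¹ * v
  have h2 : (v : G) = (u : G) * (ρ (u : G))⁻¹ * ρ (v : G) := by rw [h1]; group
  rw [map_mul, map_inv]
  conv_rhs => rw [h2]
  group

/-- The symmetric space `U/H`, embedded in `U` as the submanifold `{u ρ(u)⁻¹ | u ∈ U}`. -/
def symmetricSpace (τ ρ : G ≃* G) : Set G := Set.range (cartanEmbedding τ ρ)

end LaxFlow

end

/-!
Let `u = g⁻¹ g_x` and let `Ad` be the adjoint action. The frames `E₊ = E 1` and `E₋ = E (-1)` have the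
logarithmic derivatives `(±a + u) dx ± Ad(g⁻¹) b dt`, so that `s = E₋ E₊⁻¹` satisfies
`s⁻¹ s_x = -2 Ad(E₊) a` and `s⁻¹ s_t = -2 Ad(k) b` with `k = E₊ g⁻¹`. The derivative of the adjoint
action is `d(Ad(F) ξ) = [dF F⁻¹, Ad(F) ξ]` (`hasFDerivAt_adjointL`). Here `(E₊)_t E₊⁻¹ = Ad(k) b`,
and `k_x k⁻¹ = Ad(E₊) a` because the contributions of `u` cancel. Hence
`(Ad(E₊) a)_t + (Ad(k) b)_x = [Ad(k) b, Ad(E₊) a] + [Ad(E₊) a, Ad(k) b] = 0`, that is, the tension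
`(s⁻¹ s_x)_t + (s⁻¹ s_t)_x` vanishes (`tension_frame_mul_inv`).

Vanishing tension makes `s` a critical point of the energy among all maps into `G`, hence among maps
into any subset `N` that contains the values of `s` (`isHarmonicInto_of_tension_eq_zero`). Indeed, if
`η` is the variation field, the Maurer–Cartan equation gives
`(S⁻¹ S_x)_ε = η_x + [S⁻¹ S_x, η]`, and likewise for `t`; the bracket terms cancel in the derivative
of `⟨S⁻¹ S_x, S⁻¹ S_t⟩` by the invariance of the form, and what remains is a divergence minus the
product of `η` with the tension.

It remains to locate the values of `s`. An automorphism that fixes `g` and whose differential carries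
the Lax connection for `lam` to the one for `mu` carries the frame `E lam` to `E mu`, since a map is
determined by its logarithmic derivative and its initial value (`map_frame`, `eq_of_logDeriv_eq`).
Thus `τ` fixes both frames, and `σ^m`, which acts as `-1` on `a` and `b`, exchanges them; so
`s = E₋ σ^m(E₋)⁻¹` is the Cartan embedding of the coset of `E₋`.

The Maurer–Cartan equation `fderiv_logDeriv_sub` is obtained in the preferred chart at the identity:
there every logarithmic derivative is the pull-back of one form `maurerCartan`, and the left-invariant
vector fields defining the bracket are the columns of its inverse (`bracket_eq`). Only real
differentials occur, so `G` is first regarded as a real Lie group (`lieGroup_real`).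
-/

noncomputable section

namespace LaxFlow

open Filter Topology MeasureTheory

/-! ### Complex Lie groups as real Lie groups -/

section RealLieGroup

variable {V : Type*} [NormedAddCommGroup V] [NormedSpace ℂ V]
variable {G : Type*} [TopologicalSpace G] [ChartedSpace V G]

variable (V G) in
theorem isManifold_real [IsManifold 𝓘(ℂ, V) ω G] : IsManifold 𝓘(ℝ, V) ∞ G := by
  refine isManifold_of_contDiffOn _ _ _ fun e e' he he' => ?_
  have h := (contDiffGroupoid ω 𝓘(ℂ, V)).compatible he he'
  rw [contDiffGroupoid, mem_groupoid_of_pregroupoid] at h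
  exact (h.1.restrict_scalars ℝ).of_le (by simp)

theorem contMDiff_real {W : Type*} [NormedAddCommGroup W] [NormedSpace ℂ W]
    {M : Type*} [TopologicalSpace M] [ChartedSpace W M] {f : M → G}
    (hf : ContMDiff 𝓘(ℂ, W) 𝓘(ℂ, V) ω f) : ContMDiff 𝓘(ℝ, W) 𝓘(ℝ, V) ∞ f := by
  intro x
  have h := contMDiffAt_iff.1 (hf x)
  exact contMDiffAt_iff.2 ⟨h.1, (h.2.restrict_scalars ℝ).of_le (by simp)⟩

variable (V G) in
/-- A complex Lie group is a smooth real Lie group. -/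
theorem lieGroup_real [Group G] [LieGroup 𝓘(ℂ, V) ω G] : LieGroup 𝓘(ℝ, V) ∞ G where
  toIsManifold := isManifold_real V G
  contMDiff_mul := by
    have h := contMDiff_mul 𝓘(ℂ, V) ω (G := G)
    intro x
    have hx := contMDiffAt_iff.1 (h x)
    exact contMDiffAt_iff.2 ⟨hx.1, (hx.2.restrict_scalars ℝ).of_le (by simp)⟩
  contMDiff_inv := contMDiff_real (contMDiff_inv 𝓘(ℂ, V) ω)

end RealLieGroup

/-! ### Logarithmic derivatives -/

section LogDeriv

variable {V : Type*} [NormedAddCommGroup V] [NormedSpace ℂ V]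
variable {G : Type*} [TopologicalSpace G] [ChartedSpace V G] [Group G]
variable {W : Type*} [NormedAddCommGroup W] [NormedSpace ℝ W]

variable (V) in
/-- The left logarithmic derivative `f⁻¹ df` at `p` of a map `f` from a normed space to `G`, as a
linear map; on the plane this is `leftLogDeriv`. -/
def logDeriv (f : W → G) (p : W) : W →L[ℝ] V :=
  mfderiv 𝓘(ℝ, W) 𝓘(ℝ, V) (fun q => (f p)⁻¹ * f q) p

variable (V) in
/-- The adjoint action `adjoint` as a continuous real-linear map. -/
def adjointL (h : G) : V →L[ℝ] V :=
  mfderiv 𝓘(ℝ, V) 𝓘(ℝ, V) (fun x : G => h * x * h⁻¹) 1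

variable (V) in
/-- The differential at the identity of an automorphism, as a continuous real-linear map. -/
def differentialL (φ : G ≃* G) : V →L[ℝ] V :=
  mfderiv 𝓘(ℝ, V) 𝓘(ℝ, V) (fun x : G => φ x) 1

theorem adjoint_eq (h : G) (ξ : V) : adjoint h ξ = adjointL V h ξ := rfl
theorem differential_eq (φ : G ≃* G) (ξ : V) : differential φ ξ = differentialL V φ ξ := rfl
theorem logDx_eq (f : ℝ × ℝ → G) (p : ℝ × ℝ) : logDx V f p = logDeriv V f p (1, 0) := rfl
theorem logDt_eq (f : ℝ × ℝ → G) (p : ℝ × ℝ) : logDt V f p = logDeriv V f p (0, 1) := rfl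

@[simp] theorem logDeriv_const (c : G) (p : W) : logDeriv V (fun _ : W => c) p = 0 :=
  mfderiv_const

@[simp] theorem adjointL_one (ξ : V) : adjointL V (1 : G) ξ = ξ := by
  have e : (fun x : G => 1 * x * 1⁻¹) = id := by ext x; simp
  rw [adjointL, e]
  exact congrArg (fun L => L ξ) (mfderiv_id (I := 𝓘(ℝ, V)) (x := (1 : G)))

variable [LieGroup 𝓘(ℝ, V) ∞ G]

theorem contMDiff_mul_left_real (h : G) :
    ContMDiff 𝓘(ℝ, V) 𝓘(ℝ, V) ∞ (fun x : G => h * x) := contMDiff_mul_left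

theorem contMDiff_conj (h : G) :
    ContMDiff 𝓘(ℝ, V) 𝓘(ℝ, V) ∞ (fun x : G => h * x * h⁻¹) :=
  (contMDiff_mul_right (I := 𝓘(ℝ, V)) (a := h⁻¹)).comp (contMDiff_mul_left_real h)

theorem mdifferentiableAt_translate {f : W → G} {p : W}
    (hf : MDifferentiableAt 𝓘(ℝ, W) 𝓘(ℝ, V) f p) (h : G) :
    MDifferentiableAt 𝓘(ℝ, W) 𝓘(ℝ, V) (fun q => h * f q) p :=
  ((contMDiff_mul_left_real h).mdifferentiable (by simp) _).comp p hf

/-- The differential of the multiplication at the identity is the addition. -/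
theorem mfderiv_mul_of_eq_one {f h : W → G} {p : W}
    (hf : MDifferentiableAt 𝓘(ℝ, W) 𝓘(ℝ, V) f p) (hh : MDifferentiableAt 𝓘(ℝ, W) 𝓘(ℝ, V) h p)
    (hf1 : f p = 1) (hh1 : h p = 1) {A B : W →L[ℝ] V} (hA : A = mfderiv 𝓘(ℝ, W) 𝓘(ℝ, V) f p)
    (hB : B = mfderiv 𝓘(ℝ, W) 𝓘(ℝ, V) h p) (w : W) :
    mfderiv 𝓘(ℝ, W) 𝓘(ℝ, V) (fun q => f q * h q) p w = A w + B w := by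
  subst hA hB
  have hm : MDifferentiableAt (𝓘(ℝ, V).prod 𝓘(ℝ, V)) 𝓘(ℝ, V)
      (fun z : G × G => z.1 * z.2) (1, 1) :=
    (contMDiff_mul 𝓘(ℝ, V) ∞).mdifferentiable (by simp) _
  have h1 := mfderiv_comp_apply_of_eq (x := p) (f := fun q => (f q, h q)) hm (hf.prodMk hh)
    (by rw [hf1, hh1]) w
  have h2 := mfderiv_prod_eq_add_apply hm
    (v := ((mfderiv 𝓘(ℝ, W) 𝓘(ℝ, V) f p w, mfderiv 𝓘(ℝ, W) 𝓘(ℝ, V) h p w) : V × V))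
  have hr : ∀ u : V, (mfderiv 𝓘(ℝ, V) 𝓘(ℝ, V) (fun z : G => z * 1) 1 u : V) = u := by
    have e : (fun z : G => z * (1 : G)) = id := by ext; simp
    rw [e]
    exact fun u => congrArg (fun L => L u) (mfderiv_id (I := 𝓘(ℝ, V)) (x := (1 : G)))
  have hl : ∀ u : V, (mfderiv 𝓘(ℝ, V) 𝓘(ℝ, V) (fun z : G => 1 * z) 1 u : V) = u := by
    have e : (fun z : G => (1 : G) * z) = id := by ext; simp
    rw [e]
    exact fun u => congrArg (fun L => L u) (mfderiv_id (I := 𝓘(ℝ, V)) (x := (1 : G)))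
  have h3 := congrArg (fun L => L w) (hf.mfderiv_prod hh)
  exact (h1.trans (congrArg _ h3)).trans (h2.trans (congrArg₂ (· + · : V → V → V) (hr _) (hl _)))

/-- The product rule for logarithmic derivatives, `(f h)⁻¹ d(f h) = Ad(h⁻¹) (f⁻¹ df) + h⁻¹ dh`. -/
theorem logDeriv_mul {f h : W → G} {p : W}
    (hf : MDifferentiableAt 𝓘(ℝ, W) 𝓘(ℝ, V) f p) (hh : MDifferentiableAt 𝓘(ℝ, W) 𝓘(ℝ, V) h p)
    (w : W) :
    logDeriv V (fun q => f q * h q) p w =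
      adjointL V (h p)⁻¹ (logDeriv V f p w) + logDeriv V h p w := by
  have e : (fun q => (f p * h p)⁻¹ * (f q * h q)) =
      fun q => ((fun x => (h p)⁻¹ * x * ((h p)⁻¹)⁻¹) ∘ (fun q => (f p)⁻¹ * f q)) q *
        ((h p)⁻¹ * h q) := by
    ext q; simp [mul_assoc]
  have hc := (contMDiff_conj (V := V) (h p)⁻¹).mdifferentiable (by simp) 1
  have hf' := mdifferentiableAt_translate hf (f p)⁻¹
  have hh' := mdifferentiableAt_translate hh (h p)⁻¹
  rw [logDeriv, e]
  refine (mfderiv_mul_of_eq_one ?_ hh' ?_ ?_ rfl rfl w).trans ?_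
  · exact MDifferentiableAt.comp_of_eq p hc hf' (inv_mul_cancel _)
  · simp
  · simp
  · congr 1
    exact mfderiv_comp_apply_of_eq (x := p) hc hf' (by simp) w

theorem logDeriv_map {f : W → G} {p : W} (hf : MDifferentiableAt 𝓘(ℝ, W) 𝓘(ℝ, V) f p)
    {φ : G ≃* G} (hφ : ContMDiff 𝓘(ℝ, V) 𝓘(ℝ, V) ∞ (fun x : G => φ x)) (w : W) :
    logDeriv V (fun q => φ (f q)) p w = differentialL V φ (logDeriv V f p w) := by
  have e : (fun q => (φ (f p))⁻¹ * φ (f q)) = (fun x => φ x) ∘ fun q => (f p)⁻¹ * f q := by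
    ext q; simp
  rw [logDeriv, e]
  exact mfderiv_comp_apply_of_eq (x := p) (hφ.mdifferentiable (by simp) 1)
    (mdifferentiableAt_translate hf (f p)⁻¹) (by simp) w

theorem logDeriv_comp {W' : Type*} [NormedAddCommGroup W'] [NormedSpace ℝ W']
    {f : W → G} {k : W' → W} {p : W'} (hf : MDifferentiableAt 𝓘(ℝ, W) 𝓘(ℝ, V) f (k p))
    {k' : W' →L[ℝ] W} (hk : HasFDerivAt k k' p) (w : W') :
    logDeriv V (fun q => f (k q)) p w = logDeriv V f (k p) (k' w) := by
  have h := mfderiv_comp_apply (x := p) (mdifferentiableAt_translate hf (f (k p))⁻¹)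
    hk.hasMFDerivAt.mdifferentiableAt w
  rw [mfderiv_eq_fderiv, hk.fderiv] at h
  exact h

theorem adjointL_mul (h k : G) (ξ : V) :
    adjointL V (h * k) ξ = adjointL V h (adjointL V k ξ) := by
  have e : (fun x : G => h * k * x * (h * k)⁻¹) =
      (fun x : G => h * x * h⁻¹) ∘ fun x : G => k * x * k⁻¹ := by
    ext x; simp [mul_assoc]
  rw [adjointL, e]
  exact mfderiv_comp_apply_of_eq (x := (1 : G)) ((contMDiff_conj h).mdifferentiable (by simp) 1)
    ((contMDiff_conj k).mdifferentiable (by simp) 1) (by simp) ξ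

theorem adjointL_map {φ : G ≃* G} (hφ : ContMDiff 𝓘(ℝ, V) 𝓘(ℝ, V) ∞ (fun x : G => φ x))
    (h : G) (ξ : V) :
    differentialL V φ (adjointL V h ξ) = adjointL V (φ h) (differentialL V φ ξ) := by
  have e : (fun x : G => φ x) ∘ (fun x : G => h * x * h⁻¹) =
      (fun x : G => φ h * x * (φ h)⁻¹) ∘ fun x : G => φ x := by
    ext x; simp
  have h1 := mfderiv_comp_apply_of_eq (x := (1 : G)) (hφ.mdifferentiable (by simp) 1)
    ((contMDiff_conj (V := V) h).mdifferentiable (by simp) 1) (by simp) ξ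
  have h2 := mfderiv_comp_apply_of_eq (x := (1 : G))
    ((contMDiff_conj (V := V) (φ h)).mdifferentiable (by simp) 1)
    (hφ.mdifferentiable (by simp) 1) (by simp) ξ
  rw [e] at h1
  exact h1.symm.trans h2

theorem logDeriv_inv {f : W → G} {p : W} (hf : MDifferentiableAt 𝓘(ℝ, W) 𝓘(ℝ, V) f p) (w : W) :
    logDeriv V (fun q => (f q)⁻¹) p w = -adjointL V (f p) (logDeriv V f p w) := by
  have hi : MDifferentiableAt 𝓘(ℝ, W) 𝓘(ℝ, V) (fun q => (f q)⁻¹) p :=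
    ((contMDiff_inv 𝓘(ℝ, V) ∞).mdifferentiable (by simp) _).comp p hf
  have h := logDeriv_mul hf hi w
  simp only [mul_inv_cancel, logDeriv_const, inv_inv] at h
  exact (neg_eq_of_add_eq_zero_right h.symm).symm

end LogDeriv

/-! ### Logarithmic derivatives in the preferred chart -/

section MaurerCartan

variable {V : Type*} [NormedAddCommGroup V] [NormedSpace ℂ V]
variable {G : Type*} [TopologicalSpace G] [ChartedSpace V G] [Group G]
variable {W : Type*} [NormedAddCommGroup W] [NormedSpace ℝ W]

theorem logDeriv_mul_left (h : G) (f : W → G) (p : W) :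
    logDeriv V (fun q => h * f q) p = logDeriv V f p := by
  have e : (fun q => (h * f p)⁻¹ * (h * f q)) = fun q => (f p)⁻¹ * f q := by
    ext q; simp [mul_assoc]
  rw [logDeriv, e]
  rfl

theorem _root_.Filter.EventuallyEq.logDeriv_eq {f h : W → G} {p : W} (hfh : f =ᶠ[𝓝 p] h) :
    logDeriv V f p = logDeriv V h p := by
  have e : (fun q => (f p)⁻¹ * f q) =ᶠ[𝓝 p] fun q => (h p)⁻¹ * h q := by
    filter_upwards [hfh] with q hq
    rw [hq, hfh.eq_of_nhds]
  exact e.mfderiv_eq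

variable (V G) in
/-- The preferred chart at the identity. -/
abbrev chartOne : PartialEquiv G V := extChartAt 𝓘(ℝ, V) (1 : G)

theorem one_mem_chartOne_source : (1 : G) ∈ (chartOne V G).source := mem_extChartAt_source _

variable [LieGroup 𝓘(ℝ, V) ∞ G]

/-- The logarithmic derivative, read in the preferred chart at the identity. -/
theorem logDeriv_eq_fderiv {f : W → G} {p : W} (hf : MDifferentiableAt 𝓘(ℝ, W) 𝓘(ℝ, V) f p) :
    logDeriv V f p = fderiv ℝ (fun q => chartOne V G ((f p)⁻¹ * f q)) p := by
  have h := mdifferentiableAt_translate hf (f p)⁻¹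
  refine h.mfderiv.trans ?_
  simp [writtenInExtChartAt, Function.comp_def]
  rfl

theorem contDiffAt_chartOne_comp {f : W → G} {p : W}
    (hf : ContMDiffAt 𝓘(ℝ, W) 𝓘(ℝ, V) ∞ f p) (hp : f p ∈ (chartOne V G).source) :
    ContDiffAt ℝ ∞ (fun q => chartOne V G (f q)) p := by
  rw [← contMDiffAt_iff_contDiffAt]
  exact (contMDiffAt_extChartAt' (by simpa using hp)).comp p hf

theorem eventually_mdifferentiableAt {f : W → G} {p : W}
    (hf : ContMDiffAt 𝓘(ℝ, W) 𝓘(ℝ, V) ∞ f p) :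
    ∀ᶠ q in 𝓝 p, MDifferentiableAt 𝓘(ℝ, W) 𝓘(ℝ, V) f q := by
  have : IsManifold 𝓘(ℝ, V) 1 G := IsManifold.of_le (n := ∞) (by simp)
  have h1 : ContMDiffAt 𝓘(ℝ, W) 𝓘(ℝ, V) 1 f p := hf.of_le (by simp)
  filter_upwards [(contMDiffAt_iff_contMDiffAt_nhds (by simp)).1 h1] with q hq
  exact ContMDiffAt.mdifferentiableAt hq (by simp)

theorem contDiffAt_logDeriv {f : W → G} {p : W} (hf : ContMDiffAt 𝓘(ℝ, W) 𝓘(ℝ, V) ∞ f p) :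
    ContDiffAt ℝ ∞ (logDeriv V f) p := by
  have h1 : ContMDiffAt 𝓘(ℝ, W × W) 𝓘(ℝ, V) ∞ (fun z : W × W => (f z.1)⁻¹ * f z.2) (p, p) := by
    have ha : ContMDiffAt 𝓘(ℝ, W × W) 𝓘(ℝ, V) ∞ (fun z : W × W => f z.1) (p, p) :=
      hf.comp (p, p) contDiff_fst.contMDiff.contMDiffAt
    have hb : ContMDiffAt 𝓘(ℝ, W × W) 𝓘(ℝ, V) ∞ (fun z : W × W => f z.2) (p, p) :=
      hf.comp (p, p) contDiff_snd.contMDiff.contMDiffAt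
    exact ha.inv.mul hb
  have h2 := contDiffAt_chartOne_comp h1 (by
    rw [inv_mul_cancel]; exact one_mem_chartOne_source)
  have h3 : ContDiffAt ℝ ∞
      (fun p => fderiv ℝ (fun q => chartOne V G ((f p)⁻¹ * f q)) p) p :=
    ContDiffAt.fderiv (f := fun p q => chartOne V G ((f p)⁻¹ * f q)) (g := id) h2
      contDiffAt_id (by simp)
  refine h3.congr_of_eventuallyEq ?_
  filter_upwards [eventually_mdifferentiableAt hf] with q hq
  exact logDeriv_eq_fderiv hq

theorem contDiff_logDeriv {f : W → G} (hf : ContMDiff 𝓘(ℝ, W) 𝓘(ℝ, V) ∞ f) :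
    ContDiff ℝ ∞ (logDeriv V f) :=
  contDiff_iff_contDiffAt.2 fun p => contDiffAt_logDeriv (hf p)

variable (V G) in
/-- The Maurer–Cartan form of `G` in the preferred chart at the identity: a one-form on `V` with
values in the Lie algebra. -/
def maurerCartan : V → V →L[ℝ] V := logDeriv V (chartOne V G).symm

theorem contMDiffAt_chartOne_symm {x : V} (hx : x ∈ (chartOne V G).target) :
    ContMDiffAt 𝓘(ℝ, V) 𝓘(ℝ, V) ∞ (chartOne V G).symm x :=
  (contMDiffOn_extChartAt_symm (1 : G)).contMDiffAt
    ((isOpen_extChartAt_target (1 : G)).mem_nhds hx)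

theorem contDiffAt_maurerCartan :
    ContDiffAt ℝ ∞ (maurerCartan V G) (chartOne V G 1) :=
  contDiffAt_logDeriv (contMDiffAt_chartOne_symm (mem_extChartAt_target _))

theorem maurerCartan_one : maurerCartan V G (chartOne V G 1) = ContinuousLinearMap.id ℝ V := by
  have hm := mem_extChartAt_target (I := 𝓘(ℝ, V)) (1 : G)
  rw [maurerCartan, logDeriv_eq_fderiv
    ((contMDiffAt_chartOne_symm hm).mdifferentiableAt (by simp))]
  have e : (fun q => chartOne V G (((chartOne V G).symm (chartOne V G 1))⁻¹ *
      (chartOne V G).symm q)) =ᶠ[𝓝 (chartOne V G 1)] id := by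
    filter_upwards [(isOpen_extChartAt_target (I := 𝓘(ℝ, V)) (1 : G)).mem_nhds hm] with q hq
    rw [(chartOne V G).left_inv one_mem_chartOne_source, inv_one, one_mul,
      (chartOne V G).right_inv hq]
    rfl
  rw [e.fderiv_eq, fderiv_id]

/-- Near `p`, the logarithmic derivative of `f` is the pull-back of the Maurer–Cartan form by the
chart representation of `f(p)⁻¹ f`. -/
theorem logDeriv_eventuallyEq {f : W → G} {p : W} (hf : ContMDiffAt 𝓘(ℝ, W) 𝓘(ℝ, V) ∞ f p) :
    ∀ᶠ q in 𝓝 p, ∀ w, logDeriv V f q w =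
      maurerCartan V G (chartOne V G ((f p)⁻¹ * f q))
        (fderiv ℝ (fun q => chartOne V G ((f p)⁻¹ * f q)) q w) := by
  have h1 : ContMDiffAt 𝓘(ℝ, W) 𝓘(ℝ, V) ∞ (fun q => (f p)⁻¹ * f q) p :=
    ((contMDiff_mul_left_real _).contMDiffAt).comp p hf
  have h2 : ContDiffAt ℝ ∞ (fun q => chartOne V G ((f p)⁻¹ * f q)) p :=
    contDiffAt_chartOne_comp h1 (by rw [inv_mul_cancel]; exact one_mem_chartOne_source)
  have hs : ∀ᶠ q in 𝓝 p, (f p)⁻¹ * f q ∈ (chartOne V G).source :=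
    h1.continuousAt.eventually_mem
      (by simpa using extChartAt_source_mem_nhds (I := 𝓘(ℝ, V)) (1 : G))
  have hd : ∀ᶠ q in 𝓝 p, DifferentiableAt ℝ (fun q => chartOne V G ((f p)⁻¹ * f q)) q := by
    have h3 : ContDiffAt ℝ 1 (fun q => chartOne V G ((f p)⁻¹ * f q)) p := h2.of_le (by simp)
    filter_upwards [h3.eventually (by simp)] with q hq
    exact hq.differentiableAt (by simp)
  filter_upwards [hs.eventually_nhds, hd] with q hq hdq w
  have e : f =ᶠ[𝓝 q] fun q => f p * (chartOne V G).symm (chartOne V G ((f p)⁻¹ * f q)) := by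
    filter_upwards [hq] with r hr
    rw [(chartOne V G).left_inv hr, mul_inv_cancel_left]
  rw [e.logDeriv_eq, logDeriv_mul_left, maurerCartan]
  exact logDeriv_comp (k := fun q => chartOne V G ((f p)⁻¹ * f q)) ((contMDiffAt_chartOne_symm
    ((chartOne V G).map_source hq.self_of_nhds)).mdifferentiableAt (by simp)) hdq.hasFDerivAt w

/-- The Maurer–Cartan equation up to a symmetric term, the second derivative of the chart
representation of `f(p)⁻¹ f`. -/
theorem exists_symm_fderiv_logDeriv {f : W → G} {p : W} (hf : ContMDiffAt 𝓘(ℝ, W) 𝓘(ℝ, V) ∞ f p) :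
    ∃ S : W → W → V, (∀ v w, S v w = S w v) ∧ ∀ v w,
      fderiv ℝ (fun q => logDeriv V f q w) p v =
        fderiv ℝ (maurerCartan V G) (chartOne V G 1) (logDeriv V f p v) (logDeriv V f p w)
          + S v w := by
  set ψ : W → V := fun q => chartOne V G ((f p)⁻¹ * f q) with hψ
  have h1 : ContMDiffAt 𝓘(ℝ, W) 𝓘(ℝ, V) ∞ (fun q => (f p)⁻¹ * f q) p :=
    ((contMDiff_mul_left_real _).contMDiffAt).comp p hf
  have h2 : ContDiffAt ℝ ∞ ψ p :=
    contDiffAt_chartOne_comp h1 (by rw [inv_mul_cancel]; exact one_mem_chartOne_source)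
  have hψp : ψ p = chartOne V G 1 := by simp [hψ]
  have hψ' : fderiv ℝ ψ p = logDeriv V f p :=
    (logDeriv_eq_fderiv (hf.mdifferentiableAt (by simp))).symm
  refine ⟨fun v w => fderiv ℝ (fderiv ℝ ψ) p v w, fun v w => ?_, fun v w => ?_⟩
  · exact (h2.isSymmSndFDerivAt (by
      rw [minSmoothness_of_isRCLikeNormedField]; exact WithTop.coe_le_coe.2 le_top)).eq v w
  · have hd : HasFDerivAt (fderiv ℝ ψ) (fderiv ℝ (fderiv ℝ ψ) p) p :=
      ((h2.fderiv_right (m := ∞) (by simp)).differentiableAt (by simp)).hasFDerivAt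
    have hT : HasFDerivAt (maurerCartan V G) (fderiv ℝ (maurerCartan V G) (chartOne V G 1))
        (ψ p) := by
      rw [hψp]
      exact (contDiffAt_maurerCartan.differentiableAt (by simp)).hasFDerivAt
    have hc := hT.comp p (h2.differentiableAt (by simp)).hasFDerivAt
    have hall := hc.clm_apply (hd.clm_apply (hasFDerivAt_const w p))
    have e : (fun q => logDeriv V f q w) =ᶠ[𝓝 p]
        fun q => (maurerCartan V G ∘ ψ) q (fderiv ℝ ψ q w) := by
      filter_upwards [logDeriv_eventuallyEq hf] with q hq
      exact hq w
    rw [(hall.congr_of_eventuallyEq e).fderiv]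
    simp only [Function.comp_apply, hψp, hψ', maurerCartan_one]
    simp [add_comm]

end MaurerCartan

/-! ### The bracket and the Maurer–Cartan form -/

section Bracket

variable {V : Type*} [NormedAddCommGroup V] [NormedSpace ℂ V]
variable {G : Type*} [TopologicalSpace G] [ChartedSpace V G] [Group G]
variable {W : Type*} [NormedAddCommGroup W] [NormedSpace ℝ W]

variable (G) in
/-- The left-invariant vector field with value `ξ` at the identity, read in the preferred chart at
the identity. -/
def leftField (ξ x : V) : V :=
  VectorField.mpullbackWithin 𝓘(ℝ, V) 𝓘(ℝ, V) (chartOne V G).symm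
    (mulInvariantVectorField (I := 𝓘(ℝ, V)) (G := G) ξ) (Set.range 𝓘(ℝ, V)) x

variable [LieGroup 𝓘(ℝ, V) ∞ G]

/-- The Maurer–Cartan form takes the constant value `ξ` on the left-invariant field of `ξ`. -/
theorem maurerCartan_leftField (ξ : V) {x : V} (hx : x ∈ (chartOne V G).target) :
    maurerCartan V G x (leftField G ξ x) = ξ := by
  have : IsManifold 𝓘(ℝ, V) 1 G := IsManifold.of_le (n := ∞) (by simp)
  set h : G := (chartOne V G).symm x
  have hl := (contMDiff_mul_left_real (V := V) h⁻¹).mdifferentiable (by simp) h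
  have hl' := (contMDiff_mul_left_real (V := V) h).mdifferentiable (by simp) 1
  have h1 := mfderiv_comp_apply (x := x) (f := (chartOne V G).symm) hl
    ((contMDiffAt_chartOne_symm hx).mdifferentiableAt (by simp)) (leftField (V := V) G ξ x)
  refine Eq.trans h1 ?_
  have hinv := isInvertible_mfderivWithin_extChartAt_symm (I := 𝓘(ℝ, V)) hx
  have h2 : mfderiv 𝓘(ℝ, V) 𝓘(ℝ, V) (chartOne V G).symm x (leftField (V := V) G ξ x) =
      mfderiv 𝓘(ℝ, V) 𝓘(ℝ, V) (fun y : G => h * y) 1 ξ := by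
    have h3 := hinv.self_apply_inverse (mulInvariantVectorField (I := 𝓘(ℝ, V)) (G := G) ξ h)
    have h4 : mfderivWithin 𝓘(ℝ, V) 𝓘(ℝ, V) (chartOne V G).symm (Set.range 𝓘(ℝ, V)) x =
      mfderiv 𝓘(ℝ, V) 𝓘(ℝ, V) (chartOne V G).symm x := by
      rw [modelWithCornersSelf_coe, Set.range_id, mfderivWithin_univ]
    exact (congrArg (fun L : V →L[ℝ] V => L (leftField G ξ x)) h4.symm).trans h3
  refine (congrArg _ h2).trans ?_
  have h5 := mfderiv_comp_apply_of_eq (x := (1 : G)) hl hl' (mul_one h) ξ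
  refine h5.symm.trans ?_
  have e : (fun y => h⁻¹ * y) ∘ (fun y => h * y) = id := by ext; simp
  rw [e]
  exact congrArg (fun L => L ξ) (mfderiv_id (I := 𝓘(ℝ, V)) (x := (1 : G)))

theorem leftField_one (ξ : V) : leftField G ξ (chartOne V G 1) = ξ := by
  have h := maurerCartan_leftField (G := G) ξ (mem_extChartAt_target (I := 𝓘(ℝ, V)) (1 : G))
  rw [maurerCartan_one] at h
  exact h

variable [CompleteSpace V]

theorem eventually_isUnit_maurerCartan :
    ∀ᶠ x in 𝓝 (chartOne V G 1), IsUnit (maurerCartan V G x) := by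
  refine contDiffAt_maurerCartan.continuousAt.eventually_mem (Units.isOpen.mem_nhds ?_)
  rw [maurerCartan_one]
  exact isUnit_one

theorem hasFDerivAt_leftField (ξ : V) :
    HasFDerivAt (leftField G ξ)
      (-(fderiv ℝ (maurerCartan V G) (chartOne V G 1)).flip ξ) (chartOne V G 1) := by
  have hT := (contDiffAt_maurerCartan (V := V) (G := G)).differentiableAt (by simp)
  have hi : HasFDerivAt Ring.inverse
      (-ContinuousLinearMap.mulLeftRight ℝ (V →L[ℝ] V) 1 1)
      (maurerCartan V G (chartOne V G 1)) := by
    rw [maurerCartan_one]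
    simpa using! hasFDerivAt_ringInverse (𝕜 := ℝ) (1 : (V →L[ℝ] V)ˣ)
  have h := (hi.comp _ hT.hasFDerivAt).clm_apply (hasFDerivAt_const ξ _)
  have e : leftField G ξ =ᶠ[𝓝 (chartOne V G 1)]
      fun x => (Ring.inverse ∘ maurerCartan V G) x ξ := by
    filter_upwards [eventually_isUnit_maurerCartan,
      (isOpen_extChartAt_target (I := 𝓘(ℝ, V)) (1 : G)).mem_nhds (mem_extChartAt_target (1 : G))] with x hx hxt
    have h1 := congrArg (fun u => (Ring.inverse (maurerCartan V G x)) u)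
      (maurerCartan_leftField ξ hxt)
    have h2 := congrArg (fun L => L (leftField G ξ x)) (Ring.inverse_mul_cancel _ hx)
    exact h2.symm.trans h1
  refine (h.congr_of_eventuallyEq e).congr_fderiv ?_
  ext v
  simp

/-- The bracket of the Lie algebra is minus the exterior derivative of the Maurer–Cartan form at
the identity. -/
theorem bracket_eq (ξ η : V) :
    bracket G ξ η = fderiv ℝ (maurerCartan V G) (chartOne V G 1) η ξ -
      fderiv ℝ (maurerCartan V G) (chartOne V G 1) ξ η := by
  have : IsManifold 𝓘(ℝ, V) 1 G := IsManifold.of_le (n := ∞) (by simp)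
  obtain ⟨Z, hZ⟩ : ∃ Z : V, Z = VectorField.lieBracketWithin ℝ (leftField G ξ) (leftField G η)
      ((chartOne V G).symm ⁻¹' Set.univ ∩ Set.range 𝓘(ℝ, V)) (chartOne V G 1) := ⟨_, rfl⟩
  have h1 : bracket G ξ η = (mfderiv 𝓘(ℝ, V) 𝓘(ℝ, V) (chartOne V G) (1 : G)).inverse Z := by
    rw [hZ]; rfl
  have h2 : bracket G ξ η = Z := by
    rw [h1, mfderiv_extChartAt_self]
    exact congrArg (fun L : V →L[ℝ] V => L Z) ContinuousLinearMap.inverse_id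
  rw [h2, hZ]
  simp only [Set.preimage_univ, modelWithCornersSelf_coe, Set.range_id, Set.univ_inter,
    VectorField.lieBracketWithin, fderivWithin_univ, (hasFDerivAt_leftField _).fderiv,
    leftField_one]
  simp
  abel

theorem bracket_swap (ξ η : V) : bracket G ξ η = -bracket G η ξ := by
  simp [bracket_eq]

/-- The Maurer–Cartan equation `dθ(v, w) = -[θ v, θ w]` for `θ = f⁻¹ df`, with the sign absorbed by
exchanging the arguments of the bracket. -/
theorem fderiv_logDeriv_sub {f : W → G} {p : W} (hf : ContMDiffAt 𝓘(ℝ, W) 𝓘(ℝ, V) ∞ f p)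
    (v w : W) :
    fderiv ℝ (fun q => logDeriv V f q w) p v - fderiv ℝ (fun q => logDeriv V f q v) p w =
      bracket G (logDeriv V f p w) (logDeriv V f p v) := by
  obtain ⟨S, hS, h⟩ := exists_symm_fderiv_logDeriv hf
  rw [h, h, hS w v, bracket_eq]
  abel

end Bracket

/-! ### The derivative of the adjoint action, and uniqueness -/

section Adjoint

variable {V : Type*} [NormedAddCommGroup V] [NormedSpace ℂ V] [CompleteSpace V]
variable {G : Type*} [TopologicalSpace G] [ChartedSpace V G] [Group G] [LieGroup 𝓘(ℝ, V) ∞ G]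
variable {W : Type*} [NormedAddCommGroup W] [NormedSpace ℝ W]

theorem bracket_neg_right (ξ η : V) : bracket G ξ (-η) = -bracket G ξ η := by
  simp [bracket_eq]
  abel

/-- The derivative of the adjoint action along `F`, in terms of the right logarithmic derivative
`dF F⁻¹ = Ad(F) (F⁻¹ dF)`. -/
theorem hasFDerivAt_adjointL {F : W → G} {p : W} (hF : ContMDiffAt 𝓘(ℝ, W) 𝓘(ℝ, V) ∞ F p) (ξ : V) :
    ∃ L : W →L[ℝ] V, HasFDerivAt (fun q => adjointL V (F q) ξ) L p ∧
      ∀ v, L v = bracket G (adjointL V (F p) (logDeriv V F p v)) (adjointL V (F p) ξ) := by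
  -- The Maurer–Cartan equation for `(q, y) ↦ c(y) F(q)⁻¹`, where `c` is a curve through the
  -- identity with velocity `ξ`.
  let l : ℝ → V := fun y => chartOne V G 1 + y • ξ
  let c : ℝ → G := fun y => (chartOne V G).symm (l y)
  have hl : ∀ y, HasFDerivAt l (ContinuousLinearMap.toSpanSingleton ℝ ξ) y := fun y =>
    (ContinuousLinearMap.toSpanSingleton ℝ ξ).hasFDerivAt.const_add _
  have hl0 : l 0 = chartOne V G 1 := by simp [l]
  have hls : ContDiff ℝ ∞ l := by fun_prop
  have hc : ContMDiffAt 𝓘(ℝ, ℝ) 𝓘(ℝ, V) ∞ c 0 :=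
    ContMDiffAt.comp (0 : ℝ) (by
      rw [hl0]; exact contMDiffAt_chartOne_symm (mem_extChartAt_target _)) hls.contMDiff.contMDiffAt
  have hc1 : logDeriv V c 0 1 = ξ := by
    have h := logDeriv_comp (V := V) (f := (chartOne V G).symm) (p := (0 : ℝ)) (k := l)
      (by
        rw [hl0]
        exact (contMDiffAt_chartOne_symm (mem_extChartAt_target _)).mdifferentiableAt (by simp))
      (hl 0) 1
    rw [hl0] at h
    refine h.trans ?_
    have h1 := maurerCartan_one (V := V) (G := G)
    rw [maurerCartan] at h1
    rw [h1]
    simp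
  have hi : ContMDiffAt 𝓘(ℝ, W) 𝓘(ℝ, V) ∞ (fun q => (F q)⁻¹) p := hF.inv
  let f : W × ℝ → G := fun z => c z.2 * (F z.1)⁻¹
  have hf : ContMDiffAt 𝓘(ℝ, W × ℝ) 𝓘(ℝ, V) ∞ f (p, 0) :=
    (ContMDiffAt.comp (p, (0 : ℝ)) hc contDiff_snd.contMDiff.contMDiffAt).mul
      (ContMDiffAt.comp (p, (0 : ℝ)) hi contDiff_fst.contMDiff.contMDiffAt)
  have hlog : ∀ q y, MDifferentiableAt 𝓘(ℝ, W) 𝓘(ℝ, V) F q →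
      MDifferentiableAt 𝓘(ℝ, ℝ) 𝓘(ℝ, V) c y → ∀ v r, logDeriv V f (q, y) (v, r) =
        adjointL V (F q) (logDeriv V c y r) - adjointL V (F q) (logDeriv V F q v) := by
    intro q y hq hy v r
    have hq' : MDifferentiableAt 𝓘(ℝ, W) 𝓘(ℝ, V) (fun q => (F q)⁻¹) q :=
      ((contMDiff_inv 𝓘(ℝ, V) ∞).mdifferentiable (by simp) _).comp q hq
    have h1 := logDeriv_mul (f := fun z : W × ℝ => c z.2) (h := fun z : W × ℝ => (F z.1)⁻¹)
      (p := (q, y))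
      (MDifferentiableAt.comp (f := Prod.snd) (q, y) hy differentiableAt_snd.mdifferentiableAt)
      (MDifferentiableAt.comp (f := Prod.fst) (q, y) hq' differentiableAt_fst.mdifferentiableAt)
      (v, r)
    have h2 := logDeriv_comp (V := V) (f := c) (p := (q, y)) (k := Prod.snd) hy
      hasFDerivAt_snd (v, r)
    have h3 := logDeriv_comp (V := V) (f := fun q => (F q)⁻¹) (p := (q, y)) (k := Prod.fst) hq'
      hasFDerivAt_fst (v, r)
    rw [h2, h3] at h1
    simp only [ContinuousLinearMap.coe_fst', ContinuousLinearMap.coe_snd', inv_inv] at h1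
    rw [logDeriv_inv hq, ← sub_eq_add_neg] at h1
    exact h1
  have hmF := eventually_mdifferentiableAt hF
  have hmc := eventually_mdifferentiableAt hc
  have hdiff : DifferentiableAt ℝ (fun z => logDeriv V f z (0, 1)) (p, 0) :=
    ((contDiffAt_logDeriv hf).clm_apply contDiffAt_const).differentiableAt (by simp)
  have hA : (fun q => adjointL V (F q) ξ) =ᶠ[𝓝 p] fun q => logDeriv V f (q, 0) (0, 1) := by
    filter_upwards [hmF] with q hq
    rw [hlog q 0 hq hmc.self_of_nhds, hc1]
    simp
  have hd1 : HasFDerivAt (fun q => logDeriv V f (q, 0) (0, 1))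
      ((fderiv ℝ (fun z => logDeriv V f z (0, 1)) (p, 0)).comp
        (ContinuousLinearMap.inl ℝ W ℝ)) p :=
    HasFDerivAt.comp (g := fun z => logDeriv V f z (0, 1)) (f := fun q : W => (q, (0 : ℝ))) p
      hdiff.hasFDerivAt (hasFDerivAt_prodMk_left p 0)
  refine ⟨_, hd1.congr_of_eventuallyEq hA, fun v => ?_⟩
  have hz : fderiv ℝ (fun z => logDeriv V f z (v, 0)) (p, 0) (0, 1) = 0 := by
    have hd : DifferentiableAt ℝ (fun z => logDeriv V f z (v, 0)) (p, 0) :=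
      ((contDiffAt_logDeriv hf).clm_apply contDiffAt_const).differentiableAt (by simp)
    have h1 : HasFDerivAt (fun y => logDeriv V f (p, y) (v, 0))
        ((fderiv ℝ (fun z => logDeriv V f z (v, 0)) (p, 0)).comp
          (ContinuousLinearMap.inr ℝ W ℝ)) 0 :=
      HasFDerivAt.comp (g := fun z => logDeriv V f z (v, 0)) (f := fun y : ℝ => (p, y)) 0
        hd.hasFDerivAt (hasFDerivAt_prodMk_right p 0)
    have e : (fun y => logDeriv V f (p, y) (v, 0)) =ᶠ[𝓝 0]
        fun _ => - adjointL V (F p) (logDeriv V F p v) := by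
      filter_upwards [hmc] with y hy
      rw [hlog p y hmF.self_of_nhds hy]
      simp
    have h2 := h1.unique ((hasFDerivAt_const _ _).congr_of_eventuallyEq e)
    simpa using congrArg (fun L => L 1) h2
  have hmc' := fderiv_logDeriv_sub hf (v, 0) (0, 1)
  rw [hz, sub_zero, hlog p 0 hmF.self_of_nhds hmc.self_of_nhds,
    hlog p 0 hmF.self_of_nhds hmc.self_of_nhds, hc1] at hmc'
  simp only [map_zero, sub_zero, zero_sub] at hmc'
  rw [bracket_neg_right, ← bracket_swap] at hmc'
  simpa using hmc'

/-- A map with vanishing logarithmic derivative is constant. -/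
theorem eq_of_logDeriv_eq_zero {k : W → G} (hk : ContMDiff 𝓘(ℝ, W) 𝓘(ℝ, V) ∞ k)
    (h0 : ∀ p w, logDeriv V k p w = 0) (p q : W) : k p = k q := by
  suffices h : IsLocallyConstant k from h.apply_eq_of_preconnectedSpace p q
  rw [IsLocallyConstant.iff_eventually_eq]
  intro p
  have h1 : ContMDiffAt 𝓘(ℝ, W) 𝓘(ℝ, V) ∞ (fun q => (k p)⁻¹ * k q) p :=
    ((contMDiff_mul_left_real _).contMDiffAt).comp p (hk p)
  have hs : ∀ᶠ q in 𝓝 p, (k p)⁻¹ * k q ∈ (chartOne V G).source :=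
    h1.continuousAt.eventually_mem
      (by simpa using extChartAt_source_mem_nhds (I := 𝓘(ℝ, V)) (1 : G))
  have h2 : ContDiffAt ℝ 1 (fun q => chartOne V G ((k p)⁻¹ * k q)) p :=
    (contDiffAt_chartOne_comp h1 (by
      rw [inv_mul_cancel]; exact one_mem_chartOne_source)).of_le (by simp)
  have hu : ∀ᶠ q in 𝓝 p, IsUnit (maurerCartan V G (chartOne V G ((k p)⁻¹ * k q))) := by
    refine h2.continuousAt.eventually (p := fun x => IsUnit (maurerCartan V G x)) ?_
    beta_reduce
    rw [inv_mul_cancel]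
    exact eventually_isUnit_maurerCartan
  obtain ⟨ε, hε, hball⟩ := Metric.eventually_nhds_iff_ball.1
    ((h2.eventually (by simp)).and (hs.and (hu.and (logDeriv_eventuallyEq (hk p)))))
  have hconst : ∀ q ∈ Metric.ball p ε,
      chartOne V G ((k p)⁻¹ * k q) = chartOne V G ((k p)⁻¹ * k p) := by
    intro q hq
    refine (convex_ball p ε).is_const_of_fderivWithin_eq_zero (𝕜 := ℝ)
      (f := fun q => chartOne V G ((k p)⁻¹ * k q))
      (fun r hr => ((hball r hr).1.differentiableAt (by simp)).differentiableWithinAt)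
      (fun r hr => ?_) hq (Metric.mem_ball_self hε)
    rw [fderivWithin_of_isOpen Metric.isOpen_ball hr]
    obtain ⟨-, -, hur, hr⟩ := hball r hr
    ext w
    have h3 := hr w
    rw [h0] at h3
    have h4 := congrArg (fun L => L (fderiv ℝ (fun q => chartOne V G ((k p)⁻¹ * k q)) r w))
      (Ring.inverse_mul_cancel _ hur)
    refine h4.symm.trans ?_
    refine (congrArg (Ring.inverse (maurerCartan V G _) : V →L[ℝ] V) h3.symm).trans ?_
    simp
  filter_upwards [Metric.ball_mem_nhds p hε] with q hq
  have h3 := (chartOne V G).injOn (hball q hq).2.1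
    (hball p (Metric.mem_ball_self hε)).2.1 (hconst q hq)
  exact (inv_mul_eq_one.1 (h3.trans (inv_mul_cancel _))).symm

/-- A map into `G` is determined by its logarithmic derivative and its value at one point. -/
theorem eq_of_logDeriv_eq {f h : W → G} (hf : ContMDiff 𝓘(ℝ, W) 𝓘(ℝ, V) ∞ f)
    (hh : ContMDiff 𝓘(ℝ, W) 𝓘(ℝ, V) ∞ h) (hlog : ∀ p w, logDeriv V f p w = logDeriv V h p w)
    {p₀ : W} (h0 : f p₀ = h p₀) (p : W) : f p = h p := by
  have hmf := hf.mdifferentiable (by simp)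
  have hmh := hh.mdifferentiable (by simp)
  have h1 := eq_of_logDeriv_eq_zero (V := V) (k := fun q => f q * (h q)⁻¹) (hf.mul hh.inv)
    (fun p w => by
      rw [logDeriv_mul (hmf p) (hh.inv.mdifferentiable (by simp) p), logDeriv_inv (hmh p), hlog,
        inv_inv, add_neg_cancel]) p p₀
  simpa [h0, mul_inv_eq_one] using h1

end Adjoint

/-! ### Integrals over compact sets -/

section Integrals

/-- Differentiation under the integral sign over a compact set. -/
theorem hasDerivAt_setIntegral_of_contDiff {P : Type*} [NormedAddCommGroup P] [NormedSpace ℝ P]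
    [MeasureSpace P] [BorelSpace P] [IsFiniteMeasureOnCompacts (volume : Measure P)]
    {e : ℝ × P → ℝ} (he : ContDiff ℝ 1 e) {K : Set P} (hK : IsCompact K) :
    HasDerivAt (fun ε => ∫ p in K, e (ε, p)) (∫ p in K, fderiv ℝ e (0, p) (1, 0)) 0 := by
  have hc : Continuous fun z => fderiv ℝ e z (1, 0) :=
    (he.continuous_fderiv (by simp)).clm_apply continuous_const
  have hsec : ∀ ε : ℝ, Continuous fun p : P => (ε, p) := fun ε => by fun_prop
  obtain ⟨C, hC⟩ := ((isCompact_Icc (a := (-1 : ℝ)) (b := 1)).prod hK).exists_bound_of_continuousOn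
    hc.continuousOn
  refine (hasDerivAt_integral_of_dominated_loc_of_deriv_le (μ := volume.restrict K)
    (F := fun ε p => e (ε, p)) (F' := fun ε p => fderiv ℝ e (ε, p) (1, 0)) (bound := fun _ => C)
    (Icc_mem_nhds (a := (-1 : ℝ)) (b := 1) (by norm_num) (by norm_num)) ?_ ?_ ?_ ?_ ?_ ?_).2
  · exact Eventually.of_forall fun ε =>
      (he.continuous.comp (hsec ε)).continuousOn.aestronglyMeasurable_of_isCompact hK
        hK.measurableSet
  · exact (he.continuous.comp (hsec 0)).continuousOn.integrableOn_compact hK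
  · exact (hc.comp (hsec 0)).continuousOn.aestronglyMeasurable_of_isCompact hK hK.measurableSet
  · filter_upwards [ae_restrict_mem hK.measurableSet] with p hp ε hε
    exact hC (ε, p) ⟨hε, hp⟩
  · exact continuousOn_const.integrableOn_compact hK
  · refine Eventually.of_forall fun p ε _ => ?_
    have h1 : HasDerivAt (fun ε : ℝ => (ε, p)) (1, 0) ε :=
      (hasDerivAt_id ε).prodMk (hasDerivAt_const ε p)
    exact ((he.differentiable (by simp) (ε, p)).hasFDerivAt).comp_hasDerivAt ε h1

/-- The divergence theorem for a function supported in a compact set. -/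
theorem setIntegral_fderiv_eq_zero {ψ : ℝ × ℝ → ℝ} (hψ : ContDiff ℝ 1 ψ) {K : Set (ℝ × ℝ)}
    (hK : IsCompact K) (h0 : ∀ p ∉ K, ψ p = 0) (v : ℝ × ℝ) :
    ∫ p in K, fderiv ℝ ψ p v = 0 := by
  have hsup : HasCompactSupport ψ := HasCompactSupport.intro hK h0
  have hsub : tsupport ψ ⊆ K :=
    closure_minimal (fun p hp => by_contra fun h => hp (h0 p h)) hK.isClosed
  have hc : Continuous fun p => fderiv ℝ ψ p v :=
    (hψ.continuous_fderiv (by simp)).clm_apply continuous_const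
  rw [setIntegral_eq_integral_of_forall_compl_eq_zero fun p hp => by
    have h := image_eq_zero_of_notMem_tsupport (f := fderiv ℝ ψ)
      (fun h => hp (hsub (tsupport_fderiv_subset ℝ h)))
    rw [h]; rfl]
  have h := integral_mul_fderiv_eq_neg_fderiv_mul_of_integrable (μ := (volume : Measure (ℝ × ℝ)))
    (f := fun _ => (1 : ℝ)) (g := ψ) (v := v)
    (by simp) (by simpa using hc.integrable_of_hasCompactSupport (hsup.fderiv_apply ℝ v))
    (by simpa using hψ.continuous.integrable_of_hasCompactSupport hsup)
    (fun _ _ => differentiableAt_const _) (fun p _ => hψ.differentiable (by simp) p)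
  simpa using h

end Integrals

/-! ### The first variation of the energy -/

section FirstVariation

theorem fderiv_slice {P E : Type*} [NormedAddCommGroup P] [NormedSpace ℝ P] [NormedAddCommGroup E]
    [NormedSpace ℝ E] {X : ℝ × P → E} {ε : ℝ} {p : P} (hX : DifferentiableAt ℝ X (ε, p)) (v : P) :
    fderiv ℝ (fun q => X (ε, q)) p v = fderiv ℝ X (ε, p) (0, v) :=
  congrArg (fun L => L v) (HasFDerivAt.comp (g := X) (f := fun q : P => (ε, q)) p hX.hasFDerivAt
    (hasFDerivAt_prodMk_right ε p)).fderiv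

variable {V : Type*} [NormedAddCommGroup V] [NormedSpace ℂ V] [FiniteDimensional ℂ V]
variable {G : Type*} [TopologicalSpace G] [ChartedSpace V G] [Group G] [LieGroup 𝓘(ℝ, V) ∞ G]

/-- The real part of a complex bilinear form is a continuous real bilinear form. -/
theorem exists_continuous_re (B : LinearMap.BilinForm ℂ V) :
    ∃ β : V →L[ℝ] V →L[ℝ] ℝ, ∀ ξ η, β ξ η = (B ξ η).re := by
  have : FiniteDimensional ℝ V := FiniteDimensional.complexToReal V
  let L : V →ₗ[ℝ] V →L[ℝ] ℝ :=
    { toFun := fun ξ => LinearMap.toContinuousLinearMap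
        (Complex.reLm ∘ₗ (B ξ).restrictScalars ℝ)
      map_add' := fun ξ η => by ext; simp
      map_smul' := fun c ξ => by
        ext η
        change (B (c • ξ) η).re = c * (B ξ η).re
        rw [← Complex.coe_smul c ξ, map_smul, LinearMap.smul_apply, smul_eq_mul,
          Complex.re_ofReal_mul] }
  exact ⟨LinearMap.toContinuousLinearMap L, fun ξ η => rfl⟩

/-- A smooth map whose tension `(s⁻¹ s_x)_t + (s⁻¹ s_t)_x` vanishes is a critical point of the
energy, for variations in any subset of `G` that contains its values. -/
theorem isHarmonicInto_of_tension_eq_zero {B : LinearMap.BilinForm ℂ V} (hB : IsInvariantForm G B)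
    {N : Set G} {s : ℝ × ℝ → G} (hs : SmoothPlaneMap V s) (hN : ∀ p, s p ∈ N)
    (h0 : ∀ p, fderiv ℝ (fun q => logDeriv V s q (1, 0)) p (0, 1) +
      fderiv ℝ (fun q => logDeriv V s q (0, 1)) p (1, 0) = 0) :
    IsHarmonicInto B N s := by
  have : CompleteSpace V := FiniteDimensional.complete ℂ V
  refine ⟨hs, hN, fun K S hK hS => ?_⟩
  obtain ⟨β, hβ⟩ := exists_continuous_re B
  have hβs : ∀ ξ η, β ξ η = β η ξ := fun ξ η => by rw [hβ, hβ, hB.symm]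
  have hβb : ∀ A C η, β (bracket G A η) C + β A (bracket G C η) = 0 := fun A C η => by
    rw [hβ, hβ, hB.ad_invariant, bracket_swap C η]
    simp
  set F : ℝ × (ℝ × ℝ) → G := fun z => S z.1 z.2
  have hF : ContMDiff 𝓘(ℝ, ℝ × (ℝ × ℝ)) 𝓘(ℝ, V) ∞ F := hS.smooth
  have hFm := hF.mdifferentiable (by simp)
  -- logarithmic derivatives of a slice
  have hslice : ∀ ε p w, logDeriv V (S ε) p w = logDeriv V F (ε, p) (0, w) := fun ε p w =>
    logDeriv_comp (f := F) (k := fun q => (ε, q)) (hFm (ε, p)) (hasFDerivAt_prodMk_right ε p) w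
  have hS0 : S 0 = s := funext hS.start
  have hsm : ∀ w, ContDiff ℝ ∞ fun z => logDeriv V F z w := fun w =>
    (contDiff_logDeriv hF).clm_apply contDiff_const
  set A := fun z => logDeriv V F z (0, (1, 0)) with hA
  set C := fun z => logDeriv V F z (0, (0, 1)) with hC
  set η := fun z => logDeriv V F z (1, 0) with hη
  have hAd : ∀ z, DifferentiableAt ℝ A z := fun z => (hsm _).differentiable (by simp) z
  have hCd : ∀ z, DifferentiableAt ℝ C z := fun z => (hsm _).differentiable (by simp) z
  have hηd : ∀ z, DifferentiableAt ℝ η z := fun z => (hsm _).differentiable (by simp) z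
  have he : ContDiff ℝ 1 fun z => β (A z) (C z) :=
    ((β.contDiff.comp (hsm _)).clm_apply (hsm _)).of_le (by simp)
  have hηC : ContDiff ℝ 1 fun z => β (η z) (C z) :=
    ((β.contDiff.comp (hsm _)).clm_apply (hsm _)).of_le (by simp)
  have hAη : ContDiff ℝ 1 fun z => β (A z) (η z) :=
    ((β.contDiff.comp (hsm _)).clm_apply (hsm _)).of_le (by simp)
  have hE : ∀ ε p, energyDensity B (S ε) p = β (A (ε, p)) (C (ε, p)) := fun ε p => by
    rw [energyDensity, logDx_eq, logDt_eq, hslice, hslice, hβ]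
  simp only [hE]
  refine (hasDerivAt_setIntegral_of_contDiff he hK).congr_deriv ?_
  -- the variation of the density is a divergence
  have hψ : ∀ (X Y : ℝ × (ℝ × ℝ) → V), (∀ z, DifferentiableAt ℝ X z) →
      (∀ z, DifferentiableAt ℝ Y z) → ∀ z v, fderiv ℝ (fun z => β (X z) (Y z)) z v =
        β (fderiv ℝ X z v) (Y z) + β (X z) (fderiv ℝ Y z v) := by
    intro X Y hX hY z v
    refine (congrArg (fun L => L v)
      ((β.hasFDerivAt.comp z (hX z).hasFDerivAt).clm_apply (hY z).hasFDerivAt).fderiv).trans ?_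
    simp [add_comm]
  have hdiv : ∀ p, fderiv ℝ (fun z => β (A z) (C z)) (0, p) (1, 0) =
      fderiv ℝ (fun q => β (η (0, q)) (C (0, q))) p (1, 0) +
        fderiv ℝ (fun q => β (A (0, q)) (η (0, q))) p (0, 1) := by
    intro p
    have hx := fderiv_logDeriv_sub (hF (0, p)) (1, 0) (0, (1, 0))
    have ht := fderiv_logDeriv_sub (hF (0, p)) (1, 0) (0, (0, 1))
    rw [sub_eq_iff_eq_add] at hx ht
    have ht0 := h0 p
    rw [← hS0] at ht0
    simp only [hslice] at ht0
    rw [fderiv_slice (hAd _), fderiv_slice (hCd _)] at ht0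
    rw [fderiv_slice (X := fun z => β (η z) (C z)) (hηC.differentiable (by simp) _),
      fderiv_slice (X := fun z => β (A z) (η z)) (hAη.differentiable (by simp) _),
      hψ A C hAd hCd, hψ η C hηd hCd, hψ A η hAd hηd, hx, ht]
    have h1 := hβb (A (0, p)) (C (0, p)) (η (0, p))
    have h2 := congrArg (fun u => β u (η (0, p))) ht0
    simp only [map_add, add_apply, map_zero,
      zero_apply] at h2 ⊢
    rw [hβs (η (0, p))]
    linear_combination h1 - h2
  simp only [hdiv]
  -- the variation field vanishes off `K`
  have hη0 : ∀ p ∉ K, η (0, p) = 0 := by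
    intro p hp
    have h := logDeriv_comp (V := V) (f := F) (p := (0 : ℝ)) (k := fun ε : ℝ => (ε, p))
      (hFm (0, p)) (hasFDerivAt_prodMk_left (0 : ℝ) p) 1
    have hconst : (fun ε : ℝ => F (ε, p)) = fun _ => s p := funext fun ε => hS.support ε p hp
    rw [hconst, logDeriv_const] at h
    exact h.symm
  have hsec : ContDiff ℝ ∞ fun q : ℝ × ℝ => ((0 : ℝ), q) := by fun_prop
  have h1 := setIntegral_fderiv_eq_zero (hηC.comp (hsec.of_le (by simp))) hK
    (fun p hp => by simp [hη0 p hp]) (1, 0)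
  have h2 := setIntegral_fderiv_eq_zero (hAη.comp (hsec.of_le (by simp))) hK
    (fun p hp => by simp [hη0 p hp]) (0, 1)
  have hint : ∀ {f : ℝ × (ℝ × ℝ) → ℝ}, ContDiff ℝ 1 f → ∀ v : ℝ × ℝ,
      IntegrableOn (fun p => fderiv ℝ (fun q : ℝ × ℝ => f (0, q)) p v) K := fun hf v =>
    ((((hf.comp (hsec.of_le (by simp))).continuous_fderiv (by simp)).clm_apply
      continuous_const).continuousOn).integrableOn_compact hK
  rw [integral_add (hint hηC _) (hint hAη _)]
  exact (congrArg₂ (· + ·) h1 h2).trans (add_zero 0)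

end FirstVariation

/-! ### The frames of the Lax pair -/

section Frames

variable {V : Type*} [NormedAddCommGroup V] [NormedSpace ℂ V]
variable {G : Type*} [TopologicalSpace G] [ChartedSpace V G] [Group G]

theorem contMDiff_mulAut_pow {σ : G ≃* G}
    (hσ : ContMDiff 𝓘(ℝ, V) 𝓘(ℝ, V) ∞ (fun x : G => σ x)) (n : ℕ) :
    ContMDiff 𝓘(ℝ, V) 𝓘(ℝ, V) ∞ (fun x : G => ((σ : MulAut G) ^ n : MulAut G) x) := by
  induction n with
  | zero => exact contMDiff_id
  | succ n ih =>
    rw [pow_succ]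
    exact ih.comp hσ

/-- The powers of `σ` act on the line spanned by an eigenvector; the factor `d` makes the induction
run. -/
theorem differential_pow_of_eigenvector {σ : G ≃* G}
    (hσ : ContMDiff 𝓘(ℝ, V) 𝓘(ℝ, V) ∞ (fun x : G => σ x))
    (hlin : ∀ (c : ℂ) (ξ : V), differential σ (c • ξ) = c • differential σ ξ)
    {c : ℂ} {ξ : V} (h : differential σ ξ = c • ξ) (n : ℕ) (d : ℂ) :
    differential ((σ : MulAut G) ^ n : MulAut G) (d • ξ) = (d * c ^ n) • ξ := by
  induction n generalizing d with
  | zero =>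
    rw [pow_zero, pow_zero, mul_one]
    exact congrArg (fun L : V →L[ℝ] V => L (d • ξ)) (mfderiv_id (I := 𝓘(ℝ, V)) (x := (1 : G)))
  | succ n ih =>
    have h1 := mfderiv_comp_apply_of_eq (x := (1 : G))
      ((contMDiff_mulAut_pow hσ n).mdifferentiable (by simp) 1) (hσ.mdifferentiable (by simp) 1)
      (map_one σ) (d • ξ)
    rw [pow_succ]
    refine Eq.trans h1 ?_
    have h2 : differential σ (d • ξ) = (d * c) • ξ := by rw [hlin, h, smul_smul]
    have h3 := ih (d * c)
    rw [← h2] at h3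
    refine Eq.trans h3 ?_
    rw [pow_succ']
    ring_nf

variable [LieGroup 𝓘(ℝ, V) ∞ G]

section Tension

variable [CompleteSpace V]

/-- The tension of `s = E₋ E₊⁻¹` vanishes, where `E₊`, `E₋` are the frames for the parameters `1`
and `-1`. -/
theorem tension_frame_mul_inv {a b : V} {g Em Ep : ℝ × ℝ → G} (hg : SmoothPlaneMap V g)
    (hm : IsFrame a b g (-1) Em) (hp : IsFrame a b g 1 Ep) (p : ℝ × ℝ) :
    fderiv ℝ (fun q => logDeriv V (fun r => Em r * (Ep r)⁻¹) q (1, 0)) p (0, 1) +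
      fderiv ℝ (fun q => logDeriv V (fun r => Em r * (Ep r)⁻¹) q (0, 1)) p (1, 0) = 0 := by
  have hgm := hg.mdifferentiable (by simp)
  have hmm := hm.smooth.mdifferentiable (by simp)
  have hpm := hp.smooth.mdifferentiable (by simp)
  have hlog : ∀ q w, logDeriv V (fun r => Em r * (Ep r)⁻¹) q w =
      adjointL V (Ep q) (logDeriv V Em q w - logDeriv V Ep q w) := fun q w => by
    rw [logDeriv_mul (hmm q) (hp.smooth.inv.mdifferentiable (by simp) q), logDeriv_inv (hpm q),
      inv_inv, map_sub, sub_eq_add_neg]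
  -- `k` conjugates `b` into `s⁻¹ s_t`, just as `Ep` conjugates `a` into `s⁻¹ s_x`
  let k : ℝ × ℝ → G := fun q => Ep q * (g q)⁻¹
  have hk : ContMDiff 𝓘(ℝ, ℝ × ℝ) 𝓘(ℝ, V) ∞ k := hp.smooth.mul hg.inv
  have hpx : ∀ q, logDeriv V Ep q (1, 0) = a + logDeriv V g q (1, 0) := fun q => by
    simpa [logDx_eq] using hp.eq_x q
  have hpt : ∀ q, logDeriv V Ep q (0, 1) = adjointL V (g q)⁻¹ b := fun q => by
    simpa [logDt_eq, adjoint_eq] using hp.eq_t q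
  have hmx : ∀ q, logDeriv V Em q (1, 0) = -a + logDeriv V g q (1, 0) := fun q => by
    simpa [logDx_eq] using hm.eq_x q
  have hmt : ∀ q, logDeriv V Em q (0, 1) = -adjointL V (g q)⁻¹ b := fun q => by
    simpa [logDt_eq, adjoint_eq, inv_neg] using hm.eq_t q
  have hx : ∀ q, logDeriv V (fun r => Em r * (Ep r)⁻¹) q (1, 0) =
      (-2 : ℝ) • adjointL V (Ep q) a := fun q => by
    rw [hlog, hpx, hmx, ← map_smul]
    congr 1
    module
  have ht : ∀ q, logDeriv V (fun r => Em r * (Ep r)⁻¹) q (0, 1) =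
      (-2 : ℝ) • adjointL V (k q) b := fun q => by
    rw [hlog, hpt, hmt, adjointL_mul, ← map_smul]
    congr 1
    module
  simp only [hx, ht]
  obtain ⟨L₁, hL₁, h₁⟩ := hasFDerivAt_adjointL (hp.smooth p) a
  obtain ⟨L₂, hL₂, h₂⟩ := hasFDerivAt_adjointL (hk p) b
  have hkx : adjointL V (k p) (logDeriv V k p (1, 0)) = adjointL V (Ep p) a := by
    rw [logDeriv_mul (hpm p) (hg.inv.mdifferentiable (by simp) p), logDeriv_inv (hgm p), inv_inv,
      hpx, map_add, map_add, map_add, map_neg, add_neg_cancel_right, ← adjointL_mul]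
    simp [k]
  have hkt : adjointL V (Ep p) (logDeriv V Ep p (0, 1)) = adjointL V (k p) b := by
    rw [hpt, adjointL_mul]
  rw [(hL₁.fun_const_smul (-2 : ℝ)).fderiv, (hL₂.fun_const_smul (-2 : ℝ)).fderiv,
    smul_apply, smul_apply, h₁, h₂, hkx, hkt,
    bracket_swap (adjointL V (Ep p) a), smul_neg, add_neg_cancel]

/-- An automorphism whose differential exchanges the Lax connections for `lam` and `mu` exchanges
the frames. -/
theorem map_frame {a b : V} {g E E' : ℝ × ℝ → G} {lam mu : ℂ} (hE : IsFrame a b g lam E)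
    (hE' : IsFrame a b g mu E') {φ : G ≃* G}
    (hφ : ContMDiff 𝓘(ℝ, V) 𝓘(ℝ, V) ∞ (fun x : G => φ x))
    (hg : ∀ p, differential φ (logDx V g p) = logDx V g p)
    (ha : differential φ (lam • a) = mu • a)
    (hb : ∀ p, differential φ (lam⁻¹ • adjoint (g p)⁻¹ b) = mu⁻¹ • adjoint (g p)⁻¹ b)
    (p : ℝ × ℝ) : φ (E p) = E' p := by
  have hEm := hE.smooth.mdifferentiable (by simp)
  have hx : ∀ q, logDeriv V (fun r => φ (E r)) q (1, 0) = logDeriv V E' q (1, 0) := fun q => by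
    rw [logDeriv_map (hEm q) hφ, ← logDx_eq, ← logDx_eq, hE.eq_x, hE'.eq_x, map_add,
      ← differential_eq, ← differential_eq, ha, hg]
  have ht : ∀ q, logDeriv V (fun r => φ (E r)) q (0, 1) = logDeriv V E' q (0, 1) := fun q => by
    rw [logDeriv_map (hEm q) hφ, ← logDt_eq, ← logDt_eq, hE.eq_t, hE'.eq_t, ← differential_eq, hb]
  refine eq_of_logDeriv_eq (V := V) (f := fun r => φ (E r)) (p₀ := (0, 0)) (hφ.comp hE.smooth)
    hE'.smooth (fun q w => ?_) (by rw [hE.initial, hE'.initial, map_one]) p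
  have hw : w = w.1 • (1, 0) + w.2 • (0, 1) := by ext <;> simp
  rw [hw, map_add, map_add, map_smul, map_smul, map_smul, map_smul, hx, ht]

end Tension

/-- The differential of an automorphism fixing `g` fixes `g⁻¹ g_x`. -/
theorem differential_logDx_of_fixed {g : ℝ × ℝ → G} (hg : SmoothPlaneMap V g) {φ : G ≃* G}
    (hφ : ContMDiff 𝓘(ℝ, V) 𝓘(ℝ, V) ∞ (fun x : G => φ x)) (hφg : ∀ p, φ (g p) = g p)
    (p : ℝ × ℝ) : differential φ (logDx V g p) = logDx V g p := by
  have h := logDeriv_map (hg.mdifferentiable (by simp) p) hφ (1, 0)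
  simp only [hφg] at h
  exact h.symm

end Frames

end LaxFlow

end

theorem proposition3p17
    {V : Type*} [NormedAddCommGroup V] [NormedSpace ℂ V] [FiniteDimensional ℂ V]
    {G : Type*} [TopologicalSpace G] [ChartedSpace V G] [Group G] [LieGroup 𝓘(ℂ, V) ω G]
    (B : LinearMap.BilinForm ℂ V) (hB : LaxFlow.IsInvariantForm G B)
    (τ : G ≃* G) (hτ : LaxFlow.IsConjInvolution V τ) (hBτ : LaxFlow.IsRealFor τ B)
    (a b : V) (ha : a ∈ LaxFlow.realForm τ) (hb : b ∈ LaxFlow.realForm τ)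
    (hab : LaxFlow.bracket G a b = 0)
    (g : ℝ × ℝ → G) (hg : LaxFlow.IsMinusOneFlow τ B a b g)
    (E : ℂ → ℝ × ℝ → G) (hE : ∀ lam : ℂ, lam ≠ 0 → LaxFlow.IsFrame a b g lam (E lam)) :
    LaxFlow.IsHarmonicInto B (LaxFlow.fixedSubgroup τ : Set G)
        (fun p => E (-1) p * (E 1 p)⁻¹) ∧
      ∀ (m : ℕ) (σ : G ≃* G), LaxFlow.IsComplexAutOfOrder V σ (2 * m) →
        (∀ x, τ (σ x) = σ.symm (τ x)) →
        a ∈ LaxFlow.eigenspace σ (2 * m) 1 → b ∈ LaxFlow.eigenspace σ (2 * m) (-1) →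
        (∀ p, g p ∈ LaxFlow.fixedSubgroup σ) →
        LaxFlow.IsHarmonicInto B (LaxFlow.symmetricSpace τ ((σ : MulAut G) ^ m : MulAut G))
          (fun p => E (-1) p * (E 1 p)⁻¹) := by
  have : LieGroup 𝓘(ℝ, V) ∞ G := LaxFlow.lieGroup_real V G
  have : CompleteSpace V := FiniteDimensional.complete ℂ V
  have hm : LaxFlow.IsFrame a b g (-1) (E (-1)) := hE (-1) (by simp)
  have hp : LaxFlow.IsFrame a b g 1 (E 1) := hE 1 one_ne_zero
  have hs : LaxFlow.SmoothPlaneMap V (fun p => E (-1) p * (E 1 p)⁻¹) :=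
    hm.smooth.mul hp.smooth.inv
  -- the differential of an automorphism that fixes `g` commutes with the adjoint action of `g`
  have hAd : ∀ {φ : G ≃* G}, ContMDiff 𝓘(ℝ, V) 𝓘(ℝ, V) ∞ (fun x : G => φ x) →
      (∀ p, φ (g p) = g p) → ∀ p (ξ : V), LaxFlow.differential φ (LaxFlow.adjoint (g p)⁻¹ ξ) =
        LaxFlow.adjoint (g p)⁻¹ (LaxFlow.differential φ ξ) := by
    intro φ hφ hφg p ξ
    have h := LaxFlow.adjointL_map (V := V) hφ (g p)⁻¹ ξ
    rwa [map_inv, hφg] at h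
  have hreal : ∀ lam : ℂ, lam ≠ 0 → (starRingEnd ℂ) lam = lam → ∀ p, τ (E lam p) = E lam p := by
    intro lam h0 hlam p
    refine LaxFlow.map_frame (hE lam h0) (hE lam h0) hτ.smooth (fun q => (hg.perp q).1) ?_
      (fun q => ?_) p
    · rw [hτ.conj_linear, hlam, ha]
    · rw [hτ.conj_linear, map_inv₀, hlam, hAd hτ.smooth hg.mem_U, hb]
  have hmU : ∀ p, E (-1) p ∈ LaxFlow.fixedSubgroup τ := hreal (-1) (by simp) (by simp)
  have hpU : ∀ p, E 1 p ∈ LaxFlow.fixedSubgroup τ := hreal 1 one_ne_zero (by simp)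
  have htension := LaxFlow.tension_frame_mul_inv hg.smooth hm hp
  refine ⟨LaxFlow.isHarmonicInto_of_tension_eq_zero hB hs
    (fun p => mul_mem (hmU p) (inv_mem (hpU p))) htension, ?_⟩
  intro m σ hσ _ haσ hbσ hgσ
  refine LaxFlow.isHarmonicInto_of_tension_eq_zero hB hs (fun p => ?_) htension
  have hm0 : (m : ℂ) ≠ 0 := by
    have := hσ.order_pos
    exact_mod_cast (by omega : m ≠ 0)
  have hρ := LaxFlow.contMDiff_mulAut_pow hσ.smooth m
  have hρg : ∀ n p, ((σ : MulAut G) ^ n : MulAut G) (g p) = g p := by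
    intro n p
    induction n with
    | zero => rfl
    | succ n ih =>
      rw [pow_succ, MulAut.mul_apply]
      exact (congrArg _ (hgσ p)).trans ih
  -- `σ^m` acts on `a` and `b` as `-1`
  have hexp : ∀ j : ℤ, j = 1 ∨ j = -1 →
      Complex.exp (2 * Real.pi * Complex.I * j / (2 * m : ℕ)) ^ m = -1 := by
    intro j hj
    rw [← Complex.exp_nat_mul]
    rcases hj with rfl | rfl
    · rw [← Complex.exp_pi_mul_I]
      congr 1
      push_cast
      field_simp
    · rw [← inv_neg_one, ← Complex.exp_pi_mul_I, ← Complex.exp_neg]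
      congr 1
      push_cast
      field_simp
  have hρa := LaxFlow.differential_pow_of_eigenvector hσ.smooth hσ.complex_linear haσ m
  have hρb := LaxFlow.differential_pow_of_eigenvector hσ.smooth hσ.complex_linear hbσ m 1
  rw [hexp 1 (Or.inl rfl)] at hρa
  rw [hexp (-1) (Or.inr rfl), one_smul] at hρb
  have hswap : ((σ : MulAut G) ^ m : MulAut G) (E (-1) p) = E 1 p := by
    refine LaxFlow.map_frame hm hp hρ
      (LaxFlow.differential_logDx_of_fixed hg.smooth hρ (hρg m)) ?_ (fun q => ?_) p
    · rw [hρa]; norm_num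
    · have h := hAd hρ (hρg m) q b
      rw [hρb, one_mul, neg_one_smul, LaxFlow.adjoint_eq _ (-b), map_neg] at h
      rw [inv_neg, inv_one, neg_one_smul, one_smul, LaxFlow.differential_eq, map_neg,
        ← LaxFlow.differential_eq, h, neg_neg, LaxFlow.adjoint_eq]
  refine ⟨QuotientGroup.mk ⟨E (-1) p, hmU p⟩, ?_⟩
  change E (-1) p * (((σ : MulAut G) ^ m : MulAut G) (E (-1) p))⁻¹ = _
  rw [hswap]
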